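/- Let $q$ be a prime power, $n=2m$ a positive even integer, $N=q^n-1$, and let $\alpha$ be a primitive element of $\mathbb{F}_{q^n}$. For $0\le u\le q^n-1$ with $q$-ary expansion $u=\sum_{i=0}^{n-1}u_iq^i$, $u_i\in\{0,\dots,q-1\}$, put $$\mathrm{wt}_q(u)=\sum_{i}u_i,\qquad O(u)=\sum_{i\text{ odd}}u_i,\qquad E(u)=\sum_{i\text{ even}}u_i .$$ For $r\ge 0$ let $M_r$ be the set of integers $k$ with $0\le k\le m(q-1)$ and $k\equiv r \pmod 2$, and for $I\subseteq M_r$ put $$Z_{r-1}=\{\alpha^u \mid 0<u\le q^n-1,\ \mathrm{wt}_q(u)\le n(q-1)-r\},$$ $$\Theta^{(r)}_k=\{\alpha^u\mid 0\le u\le q^n-1,\ \mathrm{wt}_q(u)=n(q-1)-r,\ |O(u)-E(u)|=k\},$$ $$Z_{r,I}=Z_{r-1}\setminus\bigcup_{k\in I}\Theta^{(r)}_k .$$ Words of length $N$ over $\mathbb{F}_q$ are written as elements $x=\sum_{g\in\mathbb{F}_{q^n}^*}x_g(g)$, $x_g\in\mathbb{F}_q$, of the group algebra $\mathbb{F}_q[\mathbb{F}_{q^n}^*]$,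 and cyclic codes are its ideals. Let $\mathcal{C}_q(r,I,n)^*$ be the cyclic code with zero set $Z_{r,I}$, that is, the set of all $x$ with $\sum_{g}x_g\,g^s=0$ in $\mathbb{F}_{q^n}$ for every $s\ge 0$ with $\alpha^s\in Z_{r,I}$. The minimum vectors of a code are its nonzero codewords of least Hamming weight. **Theorem.** Let $0\le\rho\le n-1$, $r=\rho(q-1)+1$ and $I\subseteq M_r$, and assume that $$\begin{cases}\{q,\ q-2,\ |q-4|\}\cap I=\emptyset & \text{if }\rho\text{ is odd},\\ \{1,3\}\cap I=\emptyset & \text{if }\rho\text{ is even}.\end{cases}$$ Then the minimum vectors of $\mathcal{C}_q(r,I,n)^*$ are exactly the words $$x=\sum_{g\in V\setminus\{0\}}\lambda\,(g),$$ where $\lambda\in\mathbb{F}_q^*$ and $V$ is any $\mathbb{F}_q$-subspace of $\mathbb{F}_{q^n}$ of dimension $n-\rho$. -/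

import Mathlib

/-! ### Combinatorics of `q`-ary expansions -/

/-- The coefficient of `q ^ i` in the `q`-ary expansion of `u`. -/
def qDigit (q u i : ℕ) : ℕ := u / q ^ i % q

/-- The `q`-weight of `u ∈ [0, q ^ n - 1]`: the sum of its `n` digits in base `q`. -/
def qWeight (q n u : ℕ) : ℕ := ∑ i ∈ Finset.range n, qDigit q u i

/-- `O(u)`: the sum of the digits of `u` at odd positions. -/
def oddWeight (q n u : ℕ) : ℕ := ∑ i ∈ Finset.range n with Odd i, qDigit q u i

/-- `E(u)`: the sum of the digits of `u` at even positions. -/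
def evenWeight (q n u : ℕ) : ℕ := ∑ i ∈ Finset.range n with Even i, qDigit q u i

/-- `M_r`: the `k` with `0 ≤ k ≤ m (q - 1)` that have the same parity as `r`. -/
def parityClass (q m r : ℕ) : Set ℕ := {k | k ≤ m * (q - 1) ∧ (Even k ↔ Even r)}

/-! ### Zero sets -/

section ZeroSets

variable {G : Type*} [Group G]

/-- `Z_r = {α ^ u | 0 < u ≤ q ^ n - 1, wt_q(u) ≤ n (q - 1) - r - 1}`; the order `r` is an integer
since `r = -1` is allowed. -/
def rmZeros (α : G) (q n : ℕ) (r : ℤ) : Set G :=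
  {β | ∃ u : ℕ, 0 < u ∧ u ≤ q ^ n - 1 ∧ (qWeight q n u : ℤ) ≤ (n : ℤ) * ((q : ℤ) - 1) - r - 1 ∧
    β = α ^ u}

/-- `Θ_k^{(r)} = {α ^ u | 0 ≤ u ≤ q ^ n - 1, wt_q(u) = n (q - 1) - r, |O(u) - E(u)| = k}`. -/
def thetaSet (α : G) (q n r k : ℕ) : Set G :=
  {β | ∃ u : ℕ, u ≤ q ^ n - 1 ∧ (qWeight q n u : ℤ) = (n : ℤ) * ((q : ℤ) - 1) - r ∧
    |(oddWeight q n u : ℤ) - (evenWeight q n u : ℤ)| = k ∧ β = α ^ u}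

/-- `Z_{r,I} = Z_{r-1} \ ⋃_{k ∈ I} Θ_k^{(r)}`. -/
def sandwichedZeros (α : G) (q n r : ℕ) (I : Set ℕ) : Set G :=
  rmZeros α q n ((r : ℤ) - 1) \ ⋃ k ∈ I, thetaSet α q n r k

end ZeroSets

/-! ### Cyclic codes as ideals of the group algebra `𝔽_q[𝔽_{q^n}^*]` -/

section Codes

variable (F : Type*) {K : Type*} [Field F] [Field K] [Algebra F K]

/-- The map `ρ_s : ∑ x_g (g) ↦ ∑ x_g g ^ s` (an algebra homomorphism, as `g ↦ g ^ s` is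
multiplicative). -/
noncomputable def powerSum (s : ℕ) : MonoidAlgebra F Kˣ →ₐ[F] K :=
  MonoidAlgebra.lift F K Kˣ ((Units.coeHom K).comp (powMonoidHom s))

theorem powerSum_apply (s : ℕ) (x : MonoidAlgebra F Kˣ) :
    powerSum F s x = x.coeff.sum fun g a => a • (g : K) ^ s := by
  simp [powerSum, MonoidAlgebra.lift_apply]

/-- The cyclic code (an ideal of the group algebra) with zero set `Z`: all words `x` such that
`ρ_s(x) = 0` for every exponent `s` with `α ^ s ∈ Z`. -/
noncomputable def cyclicCode (α : Kˣ) (Z : Set Kˣ) : Ideal (MonoidAlgebra F Kˣ) :=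
  ⨅ s ∈ {s : ℕ | α ^ s ∈ Z}, RingHom.ker (powerSum F (K := K) s)

theorem mem_cyclicCode (α : Kˣ) (Z : Set Kˣ) (x : MonoidAlgebra F Kˣ) :
    x ∈ cyclicCode F α Z ↔ ∀ s : ℕ, α ^ s ∈ Z → powerSum F s x = 0 := by
  simp [cyclicCode, Submodule.mem_iInf, RingHom.mem_ker]

/-- The punctured sandwiched Reed-Muller code `C_q(r, I, n)^*`. -/
noncomputable def puncturedSandwichedRM (α : Kˣ) (q n r : ℕ) (I : Set ℕ) :
    Ideal (MonoidAlgebra F Kˣ) :=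
  cyclicCode F α (sandwichedZeros α q n r I)

variable {F}

/-- The Hamming weight of a word: the number of its nonzero coefficients. -/
def hammingWeight {G : Type*} (x : MonoidAlgebra F G) : ℕ := x.coeff.support.card

/-- The minimum vectors of a code: its nonzero codewords of least Hamming weight. -/
def minimumVectors (C : Ideal (MonoidAlgebra F Kˣ)) : Set (MonoidAlgebra F Kˣ) :=
  {x | x ∈ C ∧ x ≠ 0 ∧ ∀ y ∈ C, y ≠ 0 → hammingWeight x ≤ hammingWeight y}

open scoped Classical in
/-- The word `∑_{g ∈ V \ {0}} c (g)` of a subspace `V`. -/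
noncomputable def subspaceWord [Fintype K] (V : Submodule F K) (c : F) : MonoidAlgebra F Kˣ :=
  ∑ g ∈ Finset.univ.filter (fun g : Kˣ => (g : K) ∈ V), MonoidAlgebra.single g c

end Codes

/-!
Write `k = n - ρ`, and let `S u = ∑ x_g g ^ u` be the power sums of a word `x`. The minimum weight is
`q ^ k - 1`, and both the bound and the case of equality come from reading the zeros of the code on
two blocks of exponents.

* Every `0 < u < q ^ k - 1` is `q ^ k - 1 - v` with `0 < v < q ^ k`, so its `q`-weight is
  `k (q - 1) - wt(v)`. It reaches the critical value `k (q - 1) - 1` only for `wt(v) = 1`, and then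
  `|O - E|` is `1` (`k` even), or `q` or `q - 2` (`k` odd). These values are not in `I`, hence
  `S u = 0`, and the BCH bound gives weight at least `q ^ k - 1` (`le_hammingWeight`).
* Likewise `u = 2 q ^ k - 1 - v = q ^ k + (q ^ k - 1 - v)` has `q`-weight `1 + k (q - 1) - wt(v)` when
  `k < n`. For `v` neither zero nor a power of `q` one has `wt(v) ≥ 2`, and in the critical case
  `wt(v) = 2` the value of `|O - E|` is `1` or `3`, respectively `q`, `q - 2` or `|q - 4|`. So
  `S u = 0` again. For `k = n` the exponent reduces to the first block modulo `q ^ n - 1`.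

For a codeword of weight `q ^ k - 1` with support `T`, put `P = X ∏_{h ∈ T} (X - h)`. As
`X ^ a P` vanishes on `T`, the coefficients of `P` satisfy a linear recurrence against the `S u`, and
the second block of zeros forces every coefficient outside the exponents `q ^ i` to vanish
(`coeff_X_mul_nodal_eq_zero`). Thus `P` is a `q`-polynomial: its roots form an `𝔽_q`-subspace `V`, and
its derivative is constant. Since `x_g P'(g)` is the power sum `S (q ^ k - 1)` for each `g ∈ T`, the
coefficients of `x` are all equal (`exists_eq_subspaceWord`).

Conversely the word of a `k`-dimensional subspace is a codeword, because `g ↦ g ^ u` is a polynomial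
function on `V` of degree at most `wt(u) < k (q - 1)`, whose sum over `V` vanishes as in the
Chevalley-Warning theorem (`sum_pow_subspace_eq_zero`).
-/

/-! ### Digit sums in base `q` -/

/-- The sum of the first `n` digits of `u` in base `q`, the digit at position `i` weighted by `c i`.
The weights `1` give `qWeight`, the weights `(-1) ^ i` give `evenWeight - oddWeight`. -/
def weightedDigitSum (c : ℕ → ℤ) (q n u : ℕ) : ℤ := ∑ i ∈ Finset.range n, c i * (qDigit q u i : ℤ)

theorem weightedDigitSum_one (q n u : ℕ) :
    weightedDigitSum (fun _ => 1) q n u = (qWeight q n u : ℤ) := by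
  simp [weightedDigitSum, qWeight]

theorem weightedDigitSum_alternating (q n u : ℕ) :
    weightedDigitSum (fun i => (-1) ^ i) q n u = (evenWeight q n u : ℤ) - oddWeight q n u := by
  unfold weightedDigitSum evenWeight oddWeight
  rw [Finset.sum_filter, Finset.sum_filter]
  push_cast
  rw [← Finset.sum_sub_distrib]
  refine Finset.sum_congr rfl fun i _ => ?_
  rcases Nat.even_or_odd i with h | h
  · simp [h, Nat.not_odd_iff_even.2 h]
  · simp [h, Nat.not_even_iff_odd.2 h]

theorem qDigit_eq_zero_of_lt {q k u i : ℕ} (hq : 2 ≤ q) (hu : u < q ^ k) (hi : k ≤ i) :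
    qDigit q u i = 0 := by
  have : u < q ^ i := hu.trans_le (Nat.pow_le_pow_right (by omega) hi)
  simp [qDigit, Nat.div_eq_of_lt this]

theorem qDigit_compl {q k v i : ℕ} (hq : 2 ≤ q) (hv : v < q ^ k) (hi : i < k) :
    qDigit q (q ^ k - 1 - v) i + qDigit q v i = q - 1 := by
  obtain ⟨j, rfl⟩ : ∃ j, k = i + (j + 1) := ⟨k - i - 1, by omega⟩
  have h1 : (q ^ (i + (j + 1)) - 1 - v) / q ^ i = q ^ (j + 1) - (v / q ^ i + 1) := by
    rw [pow_add] at hv ⊢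
    rw [← Nat.mul_sub_div v (q ^ i) (q ^ (j + 1)) hv]
    congr 1; omega
  have h2 : v / q ^ i < q * q ^ j := by
    rw [← pow_succ', Nat.div_lt_iff_lt_mul (by positivity), ← pow_add, add_comm]; exact hv
  unfold qDigit
  rw [h1, pow_succ']
  generalize v / q ^ i = a at h2
  have h3 := Nat.mul_sub_div a q (q ^ j) h2
  have h4 := Nat.div_add_mod (q * q ^ j - (a + 1)) q
  have h5 := Nat.div_add_mod a q
  have h6 : a / q < q ^ j := by
    rw [Nat.div_lt_iff_lt_mul (by omega), mul_comm]; exact h2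
  rw [h3, Nat.mul_sub] at h4
  have h7 : q * (a / q + 1) ≤ q * q ^ j := Nat.mul_le_mul_left _ h6
  rw [mul_add] at h4 h7
  omega

theorem qDigit_pow_add {q k v i : ℕ} (hq : 2 ≤ q) (hv : v < q ^ k) :
    qDigit q (q ^ k + v) i = qDigit q v i + if i = k then 1 else 0 := by
  rcases lt_trichotomy i k with h | rfl | h
  · rw [if_neg h.ne, add_zero]
    unfold qDigit
    rw [← Nat.mod_mul_right_div_self, ← Nat.mod_mul_right_div_self, ← pow_succ]
    obtain ⟨c, hc⟩ : q ^ (i + 1) ∣ q ^ k := pow_dvd_pow _ h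
    rw [hc, Nat.mul_add_mod]
  · rw [if_pos rfl, qDigit_eq_zero_of_lt hq hv le_rfl]
    unfold qDigit
    rw [Nat.add_div_left _ (by positivity), Nat.div_eq_of_lt hv]
    exact Nat.mod_eq_of_lt (by omega)
  · rw [if_neg h.ne', qDigit_eq_zero_of_lt hq hv h.le, add_zero]
    refine qDigit_eq_zero_of_lt hq (k := k + 1) ?_ h
    rw [pow_succ]
    nlinarith

theorem sum_qDigit_mul_pow (q k v : ℕ) :
    ∑ i ∈ Finset.range k, qDigit q v i * q ^ i = v % q ^ k := by
  induction k with
  | zero => simp [Nat.mod_one]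
  | succ k ih => rw [Finset.sum_range_succ, ih, Nat.mod_pow_succ, qDigit, mul_comm (q ^ k)]

theorem weightedDigitSum_of_lt (c : ℕ → ℤ) {q k n u : ℕ} (hq : 2 ≤ q) (hkn : k ≤ n)
    (hu : u < q ^ k) : weightedDigitSum c q n u = weightedDigitSum c q k u := by
  refine (Finset.sum_subset (Finset.range_subset_range.2 hkn) fun i _ hi => ?_).symm
  rw [qDigit_eq_zero_of_lt hq hu (by simpa using hi)]
  simp

theorem weightedDigitSum_compl (c : ℕ → ℤ) {q k v : ℕ} (hq : 2 ≤ q) (hv : v < q ^ k) :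
    weightedDigitSum c q k (q ^ k - 1 - v) =
      (∑ i ∈ Finset.range k, c i) * (q - 1) - weightedDigitSum c q k v := by
  unfold weightedDigitSum
  rw [Finset.sum_mul, ← Finset.sum_sub_distrib]
  refine Finset.sum_congr rfl fun i hi => ?_
  have h := qDigit_compl hq hv (Finset.mem_range.1 hi)
  have : (qDigit q (q ^ k - 1 - v) i : ℤ) = q - 1 - qDigit q v i := by omega
  rw [this]; ring

theorem weightedDigitSum_pow_add (c : ℕ → ℤ) {q k n v : ℕ} (hq : 2 ≤ q) (hkn : k < n)
    (hv : v < q ^ k) :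
    weightedDigitSum c q n (q ^ k + v) = c k + weightedDigitSum c q k v := by
  rw [← weightedDigitSum_of_lt c hq hkn.le hv]
  unfold weightedDigitSum
  simp_rw [qDigit_pow_add hq hv, Nat.cast_add, mul_add, Finset.sum_add_distrib]
  simp [hkn, add_comm]

theorem qWeight_eq_evenWeight_add_oddWeight (q n u : ℕ) :
    (qWeight q n u : ℤ) = evenWeight q n u + oddWeight q n u := by
  unfold qWeight evenWeight oddWeight
  have := Finset.sum_filter_add_sum_filter_not (Finset.range n) (fun i => Even i) (qDigit q u)
  simp only [Nat.not_even_iff_odd] at this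
  exact_mod_cast this.symm

theorem two_le_qWeight {q k v : ℕ} (hv : v < q ^ k) (h0 : v ≠ 0)
    (hpow : ∀ i, v ≠ q ^ i) : 2 ≤ qWeight q k v := by
  have hsum := sum_qDigit_mul_pow q k v
  rw [Nat.mod_eq_of_lt hv] at hsum
  by_contra! hlt
  by_cases hz : ∀ i ∈ Finset.range k, qDigit q v i = 0
  · rw [Finset.sum_eq_zero fun i hi => by rw [hz i hi, zero_mul]] at hsum
    exact h0 hsum.symm
  push Not at hz
  obtain ⟨i, hi, hne⟩ := hz
  have hw := Finset.add_sum_erase (Finset.range k) (qDigit q v) hi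
  rw [← qWeight] at hw
  have h1 : qDigit q v i = 1 := by omega
  have h2 : ∑ j ∈ (Finset.range k).erase i, qDigit q v j = 0 := by omega
  rw [Finset.sum_eq_zero_iff] at h2
  rw [Finset.sum_eq_single_of_mem i hi fun j hj hji => by
    rw [h2 j (Finset.mem_erase.2 ⟨hji, hj⟩), zero_mul], h1, one_mul] at hsum
  exact hpow i hsum.symm

theorem one_le_qWeight {q k v : ℕ} (hv : v < q ^ k) (h0 : v ≠ 0) : 1 ≤ qWeight q k v := by
  by_contra! hlt
  have hz : qWeight q k v = 0 := by omega
  have hsum := sum_qDigit_mul_pow q k v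
  rw [Nat.mod_eq_of_lt hv] at hsum
  rw [qWeight, Finset.sum_eq_zero_iff] at hz
  rw [Finset.sum_eq_zero fun i hi => by rw [hz i hi, zero_mul]] at hsum
  exact h0 hsum.symm

theorem sum_range_neg_one_pow (k : ℕ) :
    ∑ i ∈ Finset.range k, (-1 : ℤ) ^ i = if Even k then 0 else 1 := by
  induction k with
  | zero => simp
  | succ k ih =>
    rw [Finset.sum_range_succ, ih]
    by_cases h : Even k
    · simp [h, Nat.even_add_one]
    · simp [h, Nat.even_add_one, (Nat.not_even_iff_odd.1 h).neg_one_pow]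

/-! ### The zeros supplied by exponents with many digits `q - 1` -/

section Zeros

variable {G : Type*} [Group G] {α : G} {q n k r : ℕ} {I : Set ℕ}

/-- An exponent gives an element of `Z_{r,I}` as soon as it lies below the relevant weight, or on
it with `|O - E|` outside `I`; that is, no second representative of `α ^ u` interferes. -/
theorem pow_mem_sandwichedZeros (hα : orderOf α = q ^ n - 1) {u : ℕ} (hu : 0 < u)
    (hun : u < q ^ n - 1) (hw : (qWeight q n u : ℤ) ≤ n * ((q : ℤ) - 1) - r)
    (hI : (qWeight q n u : ℤ) = n * ((q : ℤ) - 1) - r →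
      ((oddWeight q n u : ℤ) - evenWeight q n u).natAbs ∉ I) :
    α ^ u ∈ sandwichedZeros α q n r I := by
  refine ⟨⟨u, hu, hun.le, by linarith, rfl⟩, ?_⟩
  simp only [Set.mem_iUnion, not_exists]
  rintro l hl ⟨u', hu', hw', hd, he⟩
  rw [pow_eq_pow_iff_modEq, hα, Nat.ModEq, Nat.mod_eq_of_lt hun] at he
  rcases hu'.lt_or_eq with h | h
  · rw [Nat.mod_eq_of_lt h] at he
    subst he
    refine hI hw' ?_
    rwa [show ((oddWeight q n u : ℤ) - evenWeight q n u).natAbs = l from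
      Int.natCast_inj.1 ((Int.natCast_natAbs _).trans hd)]
  · rw [h, Nat.mod_self] at he
    omega

/-- The conditions on `I`, as the list of values of `|O - E|` that it must avoid, in terms of
`k = n - ρ`. -/
def AvoidsValues (q k : ℕ) (I : Set ℕ) : Prop :=
  (Even k → 1 ∉ I ∧ 3 ∉ I) ∧ (Odd k → q ∉ I ∧ q - 2 ∉ I ∧ ((q : ℤ) - 4).natAbs ∉ I)

theorem pow_mem_sandwichedZeros_of_lt (hα : orderOf α = q ^ n - 1) (hq : 2 ≤ q) (hkn : k ≤ n)
    (hr : (n : ℤ) * ((q : ℤ) - 1) - r = k * ((q : ℤ) - 1) - 1) (hI : AvoidsValues q k I)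
    {u : ℕ} (hu : 0 < u) (huk : u < q ^ k - 1) : α ^ u ∈ sandwichedZeros α q n r I := by
  have hle : q ^ k ≤ q ^ n := Nat.pow_le_pow_right (by omega) hkn
  obtain ⟨v, hv, hv0, rfl⟩ : ∃ v, v < q ^ k ∧ v ≠ 0 ∧ u = q ^ k - 1 - v :=
    ⟨q ^ k - 1 - u, by omega, by omega, by omega⟩
  have hw := weightedDigitSum_compl (fun _ => 1) hq hv
  have ha := weightedDigitSum_compl (fun i => (-1) ^ i) hq hv
  rw [← weightedDigitSum_of_lt _ hq hkn (by omega)] at hw ha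
  rw [weightedDigitSum_one, weightedDigitSum_one] at hw
  rw [weightedDigitSum_alternating, weightedDigitSum_alternating, sum_range_neg_one_pow] at ha
  simp only [Finset.sum_const, Finset.card_range, nsmul_eq_mul, mul_one] at hw
  have h1 := one_le_qWeight hv hv0
  refine pow_mem_sandwichedZeros hα hu (by omega) (by omega) fun heq => ?_
  have h2 := qWeight_eq_evenWeight_add_oddWeight q k v
  rcases Nat.even_or_odd k with hk | hk
  · rw [if_pos hk] at ha
    rw [show ((oddWeight q n (q ^ k - 1 - v) : ℤ) -
      evenWeight q n (q ^ k - 1 - v)).natAbs = 1 by omega]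
    exact (hI.1 hk).1
  · rw [if_neg (Nat.not_even_iff_odd.2 hk)] at ha
    obtain ⟨i1, i2, -⟩ := hI.2 hk
    have : ((oddWeight q n (q ^ k - 1 - v) : ℤ) - evenWeight q n (q ^ k - 1 - v)).natAbs = q ∨
      ((oddWeight q n (q ^ k - 1 - v) : ℤ) -
        evenWeight q n (q ^ k - 1 - v)).natAbs = q - 2 := by omega
    rcases this with h | h <;> rw [h] <;> assumption

theorem pow_mem_sandwichedZeros_of_two_mul_sub (hα : orderOf α = q ^ n - 1) (hq : 2 ≤ q)
    (hkn : k < n) (hr : (n : ℤ) * ((q : ℤ) - 1) - r = k * ((q : ℤ) - 1) - 1)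
    (hI : AvoidsValues q k I) {v : ℕ} (hv : v < q ^ k) (hv0 : v ≠ 0) (hpow : ∀ i, v ≠ q ^ i) :
    α ^ (2 * q ^ k - 1 - v) ∈ sandwichedZeros α q n r I := by
  have hle : q ^ k * 2 ≤ q ^ n := (Nat.mul_le_mul_left _ hq).trans
    ((pow_succ q k).symm.trans_le (Nat.pow_le_pow_right (by omega) hkn))
  have hu : 2 * q ^ k - 1 - v = q ^ k + (q ^ k - 1 - v) := by omega
  rw [hu]
  have hw := weightedDigitSum_compl (fun _ => 1) hq hv
  have ha := weightedDigitSum_compl (fun i => (-1) ^ i) hq hv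
  have hw' := weightedDigitSum_pow_add (fun _ => 1) hq hkn
    (show q ^ k - 1 - v < q ^ k by omega)
  have ha' := weightedDigitSum_pow_add (fun i => (-1) ^ i) hq hkn
    (show q ^ k - 1 - v < q ^ k by omega)
  rw [hw, weightedDigitSum_one, weightedDigitSum_one] at hw'
  rw [ha, weightedDigitSum_alternating, weightedDigitSum_alternating, sum_range_neg_one_pow] at ha'
  simp only [Finset.sum_const, Finset.card_range, nsmul_eq_mul, mul_one] at hw'
  have h1 := two_le_qWeight hv hv0 hpow
  refine pow_mem_sandwichedZeros hα (by omega) (by omega) (by omega) fun heq => ?_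
  have h2 := qWeight_eq_evenWeight_add_oddWeight q k v
  generalize oddWeight q n (q ^ k + (q ^ k - 1 - v)) = o at *
  generalize evenWeight q n (q ^ k + (q ^ k - 1 - v)) = e at *
  rcases Nat.even_or_odd k with hk | hk
  · rw [if_pos hk, hk.neg_one_pow] at ha'
    have : ((o : ℤ) - e).natAbs = 1 ∨ ((o : ℤ) - e).natAbs = 3 := by omega
    obtain ⟨i1, i2⟩ := hI.1 hk
    rcases this with h | h <;> rw [h] <;> assumption
  · rw [if_neg (Nat.not_even_iff_odd.2 hk), hk.neg_one_pow] at ha'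
    obtain ⟨i1, i2, i3⟩ := hI.2 hk
    have : ((o : ℤ) - e).natAbs = q ∨ ((o : ℤ) - e).natAbs = q - 2 ∨
      ((o : ℤ) - e).natAbs = ((q : ℤ) - 4).natAbs := by omega
    rcases this with h | h | h <;> rw [h] <;> assumption

end Zeros

/-! ### Weighted power sums and the locator polynomial -/

section Locator

open Polynomial

variable {K : Type*} [Field K] {T : Finset Kˣ} {y : Kˣ → K}

theorem sum_mul_eval_eq_sum_coeff_mul (T : Finset Kˣ) (y : Kˣ → K) {A : K[X]} {N : ℕ}
    (hA : A.natDegree < N) :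
    ∑ g ∈ T, y g * A.eval (g : K) =
      ∑ j ∈ Finset.range N, A.coeff j * ∑ g ∈ T, y g * (g : K) ^ j := by
  simp_rw [eval_eq_sum_range' hA, Finset.mul_sum]
  rw [Finset.sum_comm]
  exact Finset.sum_congr rfl fun j _ => Finset.sum_congr rfl fun g _ => by ring

theorem coeff_X_mul_nodal_card_add_one (T : Finset Kˣ) :
    (X * Lagrange.nodal T (Units.val : Kˣ → K)).coeff (T.card + 1) = 1 := by
  rw [coeff_X_mul]
  have := (Lagrange.nodal_monic (s := T) (v := (Units.val : Kˣ → K))).coeff_natDegree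
  rwa [Lagrange.natDegree_nodal] at this

theorem natDegree_X_mul_nodal (T : Finset Kˣ) :
    (X * Lagrange.nodal T (Units.val : Kˣ → K)).natDegree = T.card + 1 := by
  rw [natDegree_X_mul Lagrange.nodal_ne_zero, Lagrange.natDegree_nodal]

/-- Evaluating `X ∏ (X - h)`, `h ∈ T \ {g}`, against the weights `y` isolates the term at `g`, while
its expansion in power sums keeps only the top one. -/
theorem mul_eval_X_mul_nodal_erase [DecidableEq Kˣ]
    (hS : ∀ u, 0 < u → u < T.card → ∑ g ∈ T, y g * (g : K) ^ u = 0) {g : Kˣ} (hg : g ∈ T) :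
    y g * (X * Lagrange.nodal (T.erase g) (Units.val : Kˣ → K)).eval (g : K) =
      ∑ h ∈ T, y h * (h : K) ^ T.card := by
  have hcard := Finset.card_erase_add_one hg
  have h1 := sum_mul_eval_eq_sum_coeff_mul T y
    (A := X * Lagrange.nodal (T.erase g) (Units.val : Kˣ → K)) (N := T.card + 1)
    (by rw [natDegree_X_mul_nodal]; omega)
  rw [Finset.sum_eq_single_of_mem g hg, Finset.sum_range_succ, Finset.sum_eq_zero, zero_add] at h1
  · rw [h1, ← hcard, coeff_X_mul_nodal_card_add_one, one_mul]
  · intro j hj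
    rcases Nat.eq_zero_or_pos j with rfl | h
    · rw [coeff_X_mul_zero, zero_mul]
    · rw [hS j h (Finset.mem_range.1 hj), mul_zero]
  · intro h hh hne
    rw [eval_mul, Lagrange.eval_nodal_at_node (Finset.mem_erase.2 ⟨hne, hh⟩), mul_zero, mul_zero]

theorem sum_mul_pow_card_ne_zero (hy : ∀ g ∈ T, y g ≠ 0) (hT : T.Nonempty)
    (hS : ∀ u, 0 < u → u < T.card → ∑ g ∈ T, y g * (g : K) ^ u = 0) :
    ∑ h ∈ T, y h * (h : K) ^ T.card ≠ 0 := by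
  classical
  obtain ⟨g, hg⟩ := hT
  rw [← mul_eval_X_mul_nodal_erase hS hg, eval_mul, eval_X]
  refine mul_ne_zero (hy g hg) (mul_ne_zero g.ne_zero ?_)
  refine Lagrange.eval_nodal_not_at_node fun h hh heq => ?_
  exact (Finset.mem_erase.1 hh).1 (Units.ext heq.symm)

/-- The BCH bound: `d - 1` consecutive vanishing power sums force at least `d` locators. -/
theorem le_card_of_sum_mul_pow_eq_zero {d : ℕ} (hy : ∀ g ∈ T, y g ≠ 0) (hT : T.Nonempty)
    (hS : ∀ u, 0 < u → u < d → ∑ g ∈ T, y g * (g : K) ^ u = 0) : d ≤ T.card := by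
  by_contra! hlt
  exact sum_mul_pow_card_ne_zero hy hT (fun u h0 h => hS u h0 (h.trans hlt))
    (hS _ hT.card_pos hlt)

/-- If, beyond the range of the BCH bound, the power sums with exponent `2 q ^ k - 1 - v` vanish
for `v` neither zero nor a power of `q`, the polynomial with roots `0` and `T` is a `q`-polynomial:
it has only terms `X ^ (q ^ i)`. -/
theorem coeff_X_mul_nodal_eq_zero {q k : ℕ} (hq : 2 ≤ q) (hcard : T.card + 1 = q ^ k)
    (hy : ∀ g ∈ T, y g ≠ 0) (hT : T.Nonempty)
    (hS : ∀ u, 0 < u → u < T.card → ∑ g ∈ T, y g * (g : K) ^ u = 0)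
    (hS' : ∀ v, v < q ^ k → v ≠ 0 → (∀ i, v ≠ q ^ i) →
      ∑ g ∈ T, y g * (g : K) ^ (2 * q ^ k - 1 - v) = 0)
    {j : ℕ} (hj : ∀ i, j ≠ q ^ i) :
    (X * Lagrange.nodal T (Units.val : Kˣ → K)).coeff j = 0 := by
  set P := X * Lagrange.nodal T (Units.val : Kˣ → K) with hP
  have hdeg : P.natDegree = q ^ k := by rw [hP, natDegree_X_mul_nodal, hcard]
  -- Downward induction on `j`, written as induction on the distance from the degree `q ^ k`.
  induction hd : q ^ k - j using Nat.strong_induction_on generalizing j with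
  | _ d ih =>
  rcases lt_trichotomy j (q ^ k) with hlt | heq | hgt
  swap
  · exact absurd heq (hj k)
  swap
  · exact coeff_eq_zero_of_natDegree_lt (by omega)
  rcases Nat.eq_zero_or_pos j with rfl | hpos
  · rw [hP, coeff_X_mul_zero]
  -- `X ^ a * P` vanishes on `T`; the exponent `a` pairs the coefficient at `j` with the
  -- power sum of exponent `#T`, which does not vanish.
  obtain ⟨a, ha⟩ : ∃ a, a + j = T.card := ⟨T.card - j, by omega⟩
  have h1 := sum_mul_eval_eq_sum_coeff_mul T (fun g => y g * (g : K) ^ a) (A := P)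
    (N := q ^ k + 1) (by omega)
  rw [Finset.sum_eq_zero] at h1
  swap
  · intro g hg
    rw [hP, eval_mul, Lagrange.eval_nodal_at_node hg, mul_zero, mul_zero]
  simp only [mul_assoc, ← pow_add] at h1
  rw [Finset.sum_eq_single_of_mem j (by rw [Finset.mem_range]; omega), ha] at h1
  · exact (mul_eq_zero.1 h1.symm).resolve_right (sum_mul_pow_card_ne_zero hy hT hS)
  · intro l hl hlj
    rw [Finset.mem_range] at hl
    rcases lt_or_gt_of_ne hlj with h | h
    · rcases Nat.eq_zero_or_pos l with rfl | hl0
      · rw [hP, coeff_X_mul_zero, zero_mul]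
      · rw [hS _ (by omega) (by omega), mul_zero]
    by_cases hpow : ∀ i, l ≠ q ^ i
    · rw [ih (q ^ k - l) (by omega) hpow rfl, zero_mul]
    push Not at hpow
    obtain ⟨i, rfl⟩ := hpow
    have hik : i ≤ k := (Nat.pow_le_pow_iff_right (by omega : 1 < q)).1 (by omega)
    have hv : a + q ^ i = 2 * q ^ k - 1 - (q ^ k - q ^ i + j) := by omega
    rw [hv, hS' _ (by omega) (by omega), mul_zero]
    intro e he
    rcases hik.lt_or_eq with hlt' | rfl
    · -- Here `q ^ k - q ^ i + j` lies strictly between `q ^ (k - 1)` and `q ^ k`.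
      obtain ⟨k, rfl⟩ : ∃ k', k = k' + 1 := ⟨k - 1, by omega⟩
      have h2 : q ^ i ≤ q ^ k := Nat.pow_le_pow_right (by omega) (by omega)
      have h3 : q ^ k * 2 ≤ q ^ (k + 1) := by rw [pow_succ]; exact Nat.mul_le_mul_left _ hq
      have h4 : k < e := (Nat.pow_lt_pow_iff_right (by omega : 1 < q)).1 (by omega)
      have h5 : e < k + 1 := (Nat.pow_lt_pow_iff_right (by omega : 1 < q)).1 (by omega)
      omega
    · rw [Nat.sub_self, zero_add] at he
      exact hj e he

end Locator

/-! ### Roots of `q`-polynomials -/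

section QPolynomial

open Polynomial

variable {F K : Type*} [Field F] [Fintype F] [Field K] [Algebra F K]

theorem pow_card_pow_eq_frobeniusAlgHom_pow (i : ℕ) (z : K) :
    z ^ Fintype.card F ^ i = (FiniteField.frobeniusAlgHom F K ^ i) z := by
  simp [AlgHom.coe_pow, FiniteField.coe_frobeniusAlgHom, pow_iterate]

theorem algebraMap_mul_add_pow_card_pow (c : F) (a b : K) (i : ℕ) :
    (algebraMap F K c * a + b) ^ Fintype.card F ^ i =
      algebraMap F K c * a ^ Fintype.card F ^ i + b ^ Fintype.card F ^ i := by
  simp only [pow_card_pow_eq_frobeniusAlgHom_pow, map_add, map_mul, AlgHom.commutes]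

theorem eval_algebraMap_mul_add {P : K[X]}
    (hP : ∀ j, (∀ i, j ≠ Fintype.card F ^ i) → P.coeff j = 0) (c : F) (a b : K) :
    P.eval (algebraMap F K c * a + b) = algebraMap F K c * P.eval a + P.eval b := by
  simp_rw [eval_eq_sum_range, Finset.mul_sum, ← Finset.sum_add_distrib]
  refine Finset.sum_congr rfl fun j _ => ?_
  by_cases hj : ∀ i, j ≠ Fintype.card F ^ i
  · simp [hP j hj]
  · push Not at hj
    obtain ⟨i, rfl⟩ := hj
    rw [algebraMap_mul_add_pow_card_pow]
    ring

theorem derivative_eq_C_of_qPolynomial {P : K[X]}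
    (hP : ∀ j, (∀ i, j ≠ Fintype.card F ^ i) → P.coeff j = 0) :
    derivative P = C (P.coeff 1) := by
  ext j
  rw [coeff_derivative, coeff_C]
  rcases Nat.eq_zero_or_pos j with rfl | hj
  · simp
  rw [if_neg hj.ne']
  by_cases h : ∀ i, j + 1 ≠ Fintype.card F ^ i
  · rw [hP _ h, zero_mul]
  push Not at h
  obtain ⟨i, hi⟩ := h
  have h0 : i ≠ 0 := by rintro rfl; simp at hi; omega
  have : ((j + 1 : ℕ) : K) = 0 := by
    rw [hi, Nat.cast_pow, ← map_natCast (algebraMap F K), FiniteField.cast_card_eq_zero, map_zero,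
      zero_pow h0]
  push_cast at this
  rw [this, mul_zero]

/-- The roots of a `q`-polynomial, as an `𝔽_q`-subspace; `hP` says that all terms of `P` are of the
form `a X ^ (q ^ i)`. -/
def qPolynomialRoots (P : K[X])
    (hP : ∀ j, (∀ i, j ≠ Fintype.card F ^ i) → P.coeff j = 0) : Submodule F K where
  carrier := {z | P.eval z = 0}
  add_mem' {a b} ha hb := by
    have := eval_algebraMap_mul_add hP (1 : F) a b
    simp only [Set.mem_ofPred_eq] at *
    rwa [map_one, one_mul, ha, hb, mul_zero, zero_add] at this
  zero_mem' := by
    have := eval_algebraMap_mul_add hP (0 : F) 0 0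
    simp only [Set.mem_ofPred_eq]
    simp only [map_zero, zero_mul, zero_add] at this
    rw [← coeff_zero_eq_eval_zero]
    exact hP 0 fun i => (pow_pos Fintype.card_pos i).ne
  smul_mem' c a ha := by
    have h0 : P.eval 0 = 0 := by
      rw [← coeff_zero_eq_eval_zero]
      exact hP 0 fun i => (pow_pos Fintype.card_pos i).ne
    have := eval_algebraMap_mul_add hP c a 0
    simp only [Set.mem_ofPred_eq] at *
    rw [Algebra.smul_def]
    rwa [add_zero, ha, h0, mul_zero, zero_add] at this

end QPolynomial

/-! ### Power sums over subspaces -/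

section SubspaceSums

variable {F K : Type*} [Field F] [Fintype F] [Field K] [Algebra F K]

/-- The vanishing of sums of polynomials of small degree over `𝔽_q ^ σ`, with coefficients in an
extension of `𝔽_q`. -/
theorem MvPolynomial.sum_eval_algebraMap_eq_zero {σ : Type*} [Fintype σ] [DecidableEq σ]
    (p : MvPolynomial σ K)
    (h : p.totalDegree < (Fintype.card F - 1) * Fintype.card σ) :
    ∑ c : σ → F, MvPolynomial.eval (fun i => algebraMap F K (c i)) p = 0 := by
  simp only [MvPolynomial.eval_eq']
  rw [Finset.sum_comm]
  refine Finset.sum_eq_zero fun d hd => ?_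
  obtain ⟨i, hi⟩ : ∃ i, d i < Fintype.card F - 1 := p.exists_degree_lt _ h hd
  rw [← Finset.mul_sum]
  have : ∑ c : σ → F, ∏ i, c i ^ d i = 0 := by
    rw [← Fintype.prod_sum fun i a => a ^ d i]
    exact Finset.prod_eq_zero (Finset.mem_univ i) (FiniteField.sum_pow_lt_card_sub_one F _ hi)
  have h2 := congrArg (algebraMap F K) this
  simp only [map_sum, map_prod, map_pow, map_zero] at h2
  rw [h2, mul_zero]

/-- On an `𝔽_q`-space of dimension `k`, `g ↦ g ^ u` is a polynomial function of degree at most the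
`q`-weight of `u`; hence its sum vanishes if this weight is less than `k (q - 1)`. -/
theorem sum_pow_subspace_eq_zero [Fintype K] (V : Submodule F K) [Fintype V] {n u : ℕ}
    (hu : u < Fintype.card F ^ n)
    (hw : qWeight (Fintype.card F) n u < (Fintype.card F - 1) * Module.finrank F V) :
    ∑ g : V, (g : K) ^ u = 0 := by
  classical
  set q := Fintype.card F with hq
  let b := Module.finBasis F V
  let p : MvPolynomial (Fin (Module.finrank F V)) K :=
    ∏ i ∈ Finset.range n,
      (∑ j, MvPolynomial.C ((b j : K) ^ q ^ i) * MvPolynomial.X j) ^ qDigit q u i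
  have hdeg : p.totalDegree ≤ qWeight q n u := by
    refine (MvPolynomial.totalDegree_finsetProd _ _).trans (Finset.sum_le_sum fun i _ => ?_)
    refine (MvPolynomial.totalDegree_pow _ _).trans ?_
    refine (Nat.mul_le_mul_left _
      (MvPolynomial.totalDegree_finsetSum_le (d := 1) fun j _ => ?_)).trans (mul_one _).le
    refine (MvPolynomial.totalDegree_mul _ _).trans ?_
    rw [MvPolynomial.totalDegree_C, MvPolynomial.totalDegree_X]
  have h0 := MvPolynomial.sum_eval_algebraMap_eq_zero (F := F) p (by simpa using hdeg.trans_lt hw)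
  rw [← h0, ← b.equivFun.symm.toEquiv.sum_comp]
  refine Finset.sum_congr rfl fun c _ => ?_
  have hfrob : ∀ i, ((b.equivFun.symm c : V) : K) ^ q ^ i =
      ∑ j, (b j : K) ^ q ^ i * algebraMap F K (c j) := fun i => by
    rw [Module.Basis.equivFun_symm_apply]
    simp only [hq, pow_card_pow_eq_frobeniusAlgHom_pow, Submodule.coe_sum, Submodule.coe_smul,
      map_sum, Algebra.smul_def, map_mul, AlgHom.commutes]
    exact Finset.sum_congr rfl fun j _ => mul_comm _ _
  have hsum := sum_qDigit_mul_pow q n u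
  rw [Nat.mod_eq_of_lt hu] at hsum
  simp only [p, map_prod, map_pow, map_sum, map_mul, MvPolynomial.eval_C, MvPolynomial.eval_X,
    ← hfrob, ← pow_mul]
  rw [Finset.prod_pow_eq_pow_sum]
  simp only [mul_comm (q ^ _)]
  rw [hsum]
  rfl

end SubspaceSums

/-! ### Words of subspaces -/

section SubspaceWords

variable {F K : Type*} [Field F] [Field K] [Algebra F K]

theorem powerSum_eq_sum (s : ℕ) (x : MonoidAlgebra F Kˣ) :
    powerSum F s x = ∑ g ∈ x.coeff.support, algebraMap F K (x.coeff g) * (g : K) ^ s := by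
  simp [powerSum_apply, Finsupp.sum, Algebra.smul_def]

open scoped Classical in
theorem coeff_subspaceWord [Fintype K] (V : Submodule F K) (c : F) (g : Kˣ) :
    (subspaceWord V c).coeff g = if (g : K) ∈ V then c else 0 := by
  simp [subspaceWord, MonoidAlgebra.coeff_sum, Finsupp.finsetSum_apply, Finsupp.single_apply]

open scoped Classical in
theorem support_subspaceWord [Fintype K] (V : Submodule F K) {c : F} (hc : c ≠ 0) :
    (subspaceWord V c).coeff.support = Finset.univ.filter fun g : Kˣ => (g : K) ∈ V := by
  ext g
  simp [coeff_subspaceWord, hc]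

open scoped Classical in
theorem sum_units_mem_add_zero [Fintype K] {M : Type*} [AddCommMonoid M] (V : Submodule F K)
    [Fintype V] (f : K → M) :
    ∑ g ∈ Finset.univ.filter (fun g : Kˣ => (g : K) ∈ V), f g + f 0 = ∑ v : V, f v := by
  have h1 : ∑ v : V, f v = ∑ z : K with z ∈ V, f z :=
    (Finset.sum_subtype _ (by simp) f).symm
  rw [h1, ← Finset.sum_erase_add _ f (show (0 : K) ∈ Finset.univ.filter (· ∈ V) by simp)]
  congr 1
  refine Finset.sum_nbij (fun g : Kˣ => (g : K)) ?_ Units.val_injective.injOn ?_ fun _ _ => rfl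
  · intro g hg
    simpa using hg
  · intro z hz
    simp only [Finset.coe_erase, Finset.coe_filter, Finset.mem_univ, true_and] at hz
    exact ⟨Units.mk0 z hz.2, Finset.mem_coe.2 (Finset.mem_filter.2 ⟨Finset.mem_univ _, hz.1⟩), rfl⟩

open scoped Classical in
theorem card_units_mem_add_one [Fintype F] [Fintype K] (V : Submodule F K) :
    (Finset.univ.filter fun g : Kˣ => (g : K) ∈ V).card + 1 =
      Fintype.card F ^ Module.finrank F V := by
  have h := sum_units_mem_add_zero V fun _ => 1
  rwa [← Finset.card_eq_sum_ones, ← Finset.card_eq_sum_ones, Finset.card_univ,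
    Module.card_eq_pow_finrank (K := F) (V := V)] at h

theorem hammingWeight_subspaceWord [Fintype F] [Fintype K] (V : Submodule F K) {c : F}
    (hc : c ≠ 0) :
    hammingWeight (subspaceWord V c) = Fintype.card F ^ Module.finrank F V - 1 := by
  classical
  rw [hammingWeight, support_subspaceWord V hc, ← card_units_mem_add_one V]
  rfl

theorem powerSum_subspaceWord [Fintype K] (V : Submodule F K) [Fintype V] (c : F)
    {s : ℕ} (hs : s ≠ 0) :
    powerSum F s (subspaceWord V c) = algebraMap F K c * ∑ v : V, (v : K) ^ s := by
  classical
  rw [← sum_units_mem_add_zero V fun z => z ^ s, zero_pow hs, add_zero, Finset.mul_sum,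
    subspaceWord, map_sum]
  exact Finset.sum_congr rfl fun g _ => by simp [powerSum, Algebra.smul_def]

end SubspaceWords

/-! ### Minimum vectors of the sandwiched codes -/

section MinimumVectors

variable {F K : Type*} [Field F] [Fintype F] [Field K] [Algebra F K]
  {n k r : ℕ} {α : Kˣ} {I : Set ℕ} {x : MonoidAlgebra F Kˣ}

theorem powerSum_eq_zero_of_lt (hα : orderOf α = Fintype.card F ^ n - 1) (hkn : k ≤ n)
    (hr : (n : ℤ) * ((Fintype.card F : ℤ) - 1) - r = k * ((Fintype.card F : ℤ) - 1) - 1)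
    (hI : AvoidsValues (Fintype.card F) k I)
    (hx : x ∈ puncturedSandwichedRM F α (Fintype.card F) n r I) {u : ℕ} (hu : 0 < u)
    (huk : u < Fintype.card F ^ k - 1) : powerSum F u x = 0 :=
  (mem_cyclicCode F α _ x).1 hx u
    (pow_mem_sandwichedZeros_of_lt hα Fintype.one_lt_card hkn hr hI hu huk)

theorem le_hammingWeight (hα : orderOf α = Fintype.card F ^ n - 1) (hkn : k ≤ n)
    (hr : (n : ℤ) * ((Fintype.card F : ℤ) - 1) - r = k * ((Fintype.card F : ℤ) - 1) - 1)
    (hI : AvoidsValues (Fintype.card F) k I)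
    (hx : x ∈ puncturedSandwichedRM F α (Fintype.card F) n r I) (hx0 : x ≠ 0) :
    Fintype.card F ^ k - 1 ≤ hammingWeight x := by
  refine le_card_of_sum_mul_pow_eq_zero (y := fun g => algebraMap F K (x.coeff g))
    (fun g hg => by simpa using hg) ?_ fun u hu huk => ?_
  · rw [Finsupp.support_nonempty_iff]
    simpa using hx0
  · rw [← powerSum_eq_sum]
    exact powerSum_eq_zero_of_lt hα hkn hr hI hx hu huk

variable [Fintype K]

theorem orderOf_eq_pow_finrank_sub_one (hK : Module.finrank F K = n)
    (hα : ∀ g : Kˣ, g ∈ Subgroup.zpowers α) : orderOf α = Fintype.card F ^ n - 1 := by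
  classical
  rw [orderOf_eq_card_of_forall_mem_zpowers hα, Nat.card_units, Nat.card_eq_fintype_card,
    Module.card_eq_pow_finrank (K := F) (V := K), hK]

theorem subspaceWord_mem (hα : ∀ g : Kˣ, g ∈ Subgroup.zpowers α)
    (hr : (n : ℤ) * ((Fintype.card F : ℤ) - 1) - r = k * ((Fintype.card F : ℤ) - 1) - 1)
    (V : Submodule F K) (c : F) (hV : Module.finrank F V = k) :
    subspaceWord V c ∈ puncturedSandwichedRM F α (Fintype.card F) n r I := by
  classical
  rw [puncturedSandwichedRM, mem_cyclicCode]
  rintro s ⟨⟨u, hu0, hun, hw, hs⟩, -⟩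
  have hq : 1 < Fintype.card F := Fintype.one_lt_card
  -- Only `α ^ s = α ^ u` is known, which makes the power sums with exponents `s` and `u` agree.
  have hsu : powerSum F s (subspaceWord V c) = powerSum F u (subspaceWord V c) := by
    simp only [powerSum_eq_sum]
    refine Finset.sum_congr rfl fun g _ => ?_
    obtain ⟨z, rfl⟩ := Subgroup.mem_zpowers_iff.1 (hα g)
    rw [← Units.val_pow_eq_pow_val, ← Units.val_pow_eq_pow_val, ← zpow_natCast, zpow_comm,
      zpow_natCast, hs, ← zpow_natCast, zpow_comm, zpow_natCast]
  rw [hsu, powerSum_subspaceWord V c hu0.ne', sum_pow_subspace_eq_zero V (n := n), mul_zero]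
  · have := Nat.pow_pos (n := n) (show 0 < Fintype.card F by omega)
    omega
  · rw [hV]
    zify [hq.le]
    linarith

theorem powerSum_eq_zero_of_two_mul_sub (hK : Module.finrank F K = n)
    (hα : orderOf α = Fintype.card F ^ n - 1) (hkn : k ≤ n)
    (hr : (n : ℤ) * ((Fintype.card F : ℤ) - 1) - r = k * ((Fintype.card F : ℤ) - 1) - 1)
    (hI : AvoidsValues (Fintype.card F) k I)
    (hx : x ∈ puncturedSandwichedRM F α (Fintype.card F) n r I) {v : ℕ}
    (hv : v < Fintype.card F ^ k) (hv0 : v ≠ 0) (hpow : ∀ i, v ≠ Fintype.card F ^ i) :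
    powerSum F (2 * Fintype.card F ^ k - 1 - v) x = 0 := by
  rcases hkn.lt_or_eq with h | rfl
  · exact (mem_cyclicCode F α _ x).1 hx _
      (pow_mem_sandwichedZeros_of_two_mul_sub hα Fintype.one_lt_card h hr hI hv hv0 hpow)
  -- For `k = n` the exponent reduces modulo `q ^ n - 1` to one in the range of the BCH bound.
  have hcard : Fintype.card K = Fintype.card F ^ k := by
    rw [Module.card_eq_pow_finrank (K := F) (V := K), hK]
  have h1 : v ≠ 1 := by simpa using hpow 0
  rw [← powerSum_eq_zero_of_lt hα le_rfl hr hI hx (u := Fintype.card F ^ k - v) (by omega)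
    (by omega)]
  simp only [powerSum_eq_sum]
  refine Finset.sum_congr rfl fun g _ => ?_
  rw [show 2 * Fintype.card F ^ k - 1 - v =
    (Fintype.card F ^ k - 1) + (Fintype.card F ^ k - v) by omega, pow_add, ← hcard,
    FiniteField.pow_card_sub_one_eq_one _ g.ne_zero, one_mul]

theorem exists_eq_subspaceWord (hK : Module.finrank F K = n)
    (hα : orderOf α = Fintype.card F ^ n - 1) (hkn : k ≤ n)
    (hr : (n : ℤ) * ((Fintype.card F : ℤ) - 1) - r = k * ((Fintype.card F : ℤ) - 1) - 1)
    (hI : AvoidsValues (Fintype.card F) k I)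
    (hx : x ∈ puncturedSandwichedRM F α (Fintype.card F) n r I) (hx0 : x ≠ 0)
    (hw : hammingWeight x = Fintype.card F ^ k - 1) :
    ∃ (V : Submodule F K) (c : F), Module.finrank F V = k ∧ c ≠ 0 ∧ x = subspaceWord V c := by
  classical
  have hq : 1 < Fintype.card F := Fintype.one_lt_card
  have hQ : 0 < Fintype.card F ^ k := Nat.pow_pos (by omega)
  set T := x.coeff.support with hT
  set y : Kˣ → K := fun g => algebraMap F K (x.coeff g)
  have hcard : T.card + 1 = Fintype.card F ^ k := by
    rw [hammingWeight, ← hT] at hw; omega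
  have hy : ∀ g ∈ T, y g ≠ 0 := fun g hg => by simpa [y, hT] using hg
  have hTne : T.Nonempty := by
    rw [hT, Finsupp.support_nonempty_iff]
    simpa using hx0
  have hS : ∀ u, 0 < u → u < T.card → ∑ g ∈ T, y g * (g : K) ^ u = 0 := fun u hu huk => by
    rw [← powerSum_eq_sum]
    exact powerSum_eq_zero_of_lt hα hkn hr hI hx hu (by omega)
  have hP : ∀ j, (∀ i, j ≠ Fintype.card F ^ i) →
      (Polynomial.X * Lagrange.nodal T (Units.val : Kˣ → K)).coeff j = 0 := fun j hj =>
    coeff_X_mul_nodal_eq_zero hq hcard hy hTne hS (fun v hv hv0 hpow => by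
      rw [← powerSum_eq_sum]
      exact powerSum_eq_zero_of_two_mul_sub hK hα hkn hr hI hx hv hv0 hpow) hj
  set P := Polynomial.X * Lagrange.nodal T (Units.val : Kˣ → K) with hPdef
  have hmem : ∀ g : Kˣ, (g : K) ∈ qPolynomialRoots P hP ↔ g ∈ T := fun g => by
    change P.eval (g : K) = 0 ↔ _
    rw [hPdef, Polynomial.eval_mul, Polynomial.eval_X, mul_eq_zero, or_iff_right g.ne_zero,
      Lagrange.eval_nodal, Finset.prod_eq_zero_iff]
    constructor
    · rintro ⟨h, hh, he⟩
      rwa [Units.ext (sub_eq_zero.1 he)]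
    · exact fun hg => ⟨g, hg, sub_self _⟩
  -- The derivative of `P` is constant and takes the value `S / x_g` at each locator `g`, where `S`
  -- is the first nonzero power sum.
  have hconst : ∀ g ∈ T, y g * P.coeff 1 = ∑ h ∈ T, y h * (h : K) ^ T.card := fun g hg => by
    rw [← mul_eval_X_mul_nodal_erase hS hg]
    congr 1
    have h1 := congrArg (Polynomial.eval (g : K)) (derivative_eq_C_of_qPolynomial hP)
    rw [Polynomial.eval_C] at h1
    rw [← h1, hPdef, Polynomial.derivative_mul, Polynomial.eval_add, Polynomial.eval_mul,
      Polynomial.eval_mul, Polynomial.eval_mul, Lagrange.eval_nodal_at_node hg, mul_zero, zero_add,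
      Lagrange.eval_nodal_derivative_eval_node_eq hg]
  obtain ⟨g₀, hg₀⟩ := hTne
  have hP1 : P.coeff 1 ≠ 0 := right_ne_zero_of_mul
    ((hconst g₀ hg₀).trans_ne (sum_mul_pow_card_ne_zero hy ⟨g₀, hg₀⟩ hS))
  refine ⟨qPolynomialRoots P hP, x.coeff g₀, ?_, by simpa [hT] using hg₀, ?_⟩
  · have h1 := card_units_mem_add_one (qPolynomialRoots P hP)
    rw [Finset.filter_congr fun g _ => hmem g, Finset.filter_mem_eq_inter, Finset.univ_inter,
      hcard] at h1
    exact Nat.pow_right_injective hq h1.symm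
  · ext g
    rw [coeff_subspaceWord]
    split_ifs with h
    · refine (algebraMap F K).injective (mul_right_cancel₀ hP1 ?_)
      exact (hconst g ((hmem g).1 h)).trans (hconst g₀ hg₀).symm
    · rw [hmem, hT, Finsupp.mem_support_iff, not_not] at h
      exact h

end MinimumVectors

theorem mainTheorem6 {F K : Type*} [Field F] [Fintype F] [Field K] [Fintype K] [Algebra F K]
    (q m n ρ r : ℕ) (hq : Fintype.card F = q) (hn : n = 2 * m) (hK : Module.finrank F K = n)
    (α : Kˣ) (hα : ∀ g : Kˣ, g ∈ Subgroup.zpowers α)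
    (hρ : ρ < n) (hr : r = ρ * (q - 1) + 1)
    (I : Set ℕ) (hI : I ⊆ parityClass q m r)
    (hodd : Odd ρ → ({q, q - 2, ((q : ℤ) - 4).natAbs} : Set ℕ) ∩ I = ∅)
    (heven : Even ρ → ({1, 3} : Set ℕ) ∩ I = ∅) :
    minimumVectors (puncturedSandwichedRM F α q n r I) =
      {x | ∃ (V : Submodule F K) (c : F), Module.finrank F V = n - ρ ∧ c ≠ 0 ∧
        x = subspaceWord V c} := by
  subst hq
  have hq1 : 1 < Fintype.card F := Fintype.one_lt_card
  have hk : n - ρ ≤ n := Nat.sub_le _ _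
  have hr' : (n : ℤ) * ((Fintype.card F : ℤ) - 1) - r =
      (n - ρ : ℕ) * ((Fintype.card F : ℤ) - 1) - 1 := by
    rw [hr]
    push_cast [hq1.le, hρ.le]
    ring
  have hIk : AvoidsValues (Fintype.card F) (n - ρ) I := by
    simp only [← Set.disjoint_iff_inter_eq_empty, Set.disjoint_left, Set.mem_insert_iff,
      Set.mem_singleton_iff] at hodd heven
    refine ⟨fun h => ?_, fun h => ?_⟩
    · have h' : Even ρ := by
        rw [Nat.even_sub hρ.le] at h
        exact h.1 (hn ▸ even_two_mul m)
      exact ⟨heven h' (by simp), heven h' (by simp)⟩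
    · have h' : Odd ρ := by
        rw [Nat.odd_sub hρ.le] at h
        exact Nat.not_even_iff_odd.1 fun hc => Nat.not_even_iff_odd.2 (h.2 hc)
          (hn ▸ even_two_mul m)
      exact ⟨hodd h' (by simp), hodd h' (by simp), hodd h' (by simp)⟩
  have hord := orderOf_eq_pow_finrank_sub_one hK hα
  have hne : ∀ (V : Submodule F K) (c : F), Module.finrank F V = n - ρ → c ≠ 0 →
      subspaceWord V c ≠ 0 := fun V c hV hc h0 => by
    have h1 := hammingWeight_subspaceWord V hc
    rw [h0, hV] at h1
    have h2 := Nat.one_lt_pow (show n - ρ ≠ 0 by omega) hq1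
    simp [hammingWeight] at h1
    omega
  ext x
  constructor
  · rintro ⟨hx, hx0, hmin⟩
    obtain ⟨V, hV⟩ : ∃ V : Submodule F K, Module.finrank F V = n - ρ := by
      obtain ⟨f, hf⟩ := exists_linearIndependent_of_le_finrank (hk.trans hK.ge)
      exact ⟨_, (finrank_span_eq_card hf).trans (Fintype.card_fin _)⟩
    refine exists_eq_subspaceWord hK hord hk hr' hIk hx hx0 (le_antisymm ?_
      (le_hammingWeight hord hk hr' hIk hx hx0))
    refine (hmin _ (subspaceWord_mem hα hr' V 1 hV) (hne V 1 hV one_ne_zero)).trans ?_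
    rw [hammingWeight_subspaceWord V one_ne_zero, hV]
  · rintro ⟨V, c, hV, hc, rfl⟩
    refine ⟨subspaceWord_mem hα hr' V c hV, hne V c hV hc, fun y hy hy0 => ?_⟩
    rw [hammingWeight_subspaceWord V hc, hV]
    exact le_hammingWeight hord hk hr' hIk hy hy0
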